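/- Let $\mathcal I=\{\emptyset\}\cup\bigcup_{n\ge1}\{1,2\}^n$ be the vertex set of the infinite rooted binary tree. For $v\in\mathcal I$ write $|v|$ for its generation and $v|j$ for its ancestor in generation $j\le|v|$ (so $v|0=\emptyset$ and $v||v|=v$). Let $(T_v)_{v\in\mathcal I}$ be i.i.d. exponential random variables with mean one. For $\alpha\ge0$ the $\alpha$-Riccati cascade is the family $(\alpha^{-|v|}T_v)_{v\in\mathcal I}$; for $\alpha=0$ use the convention $0^{-0}=1$ and $0^{-j}=\infty$ for $j\ge1$. For $t>0$ the branches of the cascade that cross the horizon $t$ are given by the set of $t$-leaves $$V(t)=\Bigl\{v\in\mathcal I:\ \sum_{j=0}^{|v|-1}\alpha^{-j}T_{v|j}\le t<\sum_{j=0}^{|v|}\alpha^{-j}T_{v|j}\Bigr\},$$ and $G_t$ denotes the event that $V(t)$ is empty or finite. **Proposition.** Let $\alpha\ge0$. Then, for every $t>0$, $$\mathbb P(G_t)\ \begin{cases}=1 & \text{if }\alpha\in[0,1]\cup[2,\infty),\\ <1 & \text{if }\alpha\in(1,2).\end{cases}$$ -/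

import Mathlib

open MeasureTheory ProbabilityTheory Set
open scoped ENNReal

/-- The vertices of the infinite rooted binary tree: finite words over a two-letter alphabet. The
root is the empty word, the generation `|v|` is `v.length`, and the ancestor `v|j` of `v` in
generation `j ≤ |v|` is the prefix `v.take j`. -/
abbrev TreeVertex : Type := List Bool

namespace AlphaRiccati

/-- The partial sum `∑_{j < n} α^{-j} τ_{v|j}` along the path from the root to `v`, where `τ` is a
family of clocks indexed by the tree. Values are extended nonnegative reals, so that `α = 0` is
covered with `0^{-0} = 1` and `0^{-j} = ∞` for `j ≥ 1`. -/
noncomputable def pathTime (α : ℝ) (τ : TreeVertex → ℝ) (v : TreeVertex) (n : ℕ) : ℝ≥0∞ :=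
  ∑ j ∈ Finset.range n, (ENNReal.ofReal α ^ j)⁻¹ * ENNReal.ofReal (τ (v.take j))

/-- The set `V(t)` of `t`-leaves: the vertices `v` whose own edge crosses the horizon `t`, that is
`∑_{j=0}^{|v|-1} α^{-j} τ_{v|j} ≤ t < ∑_{j=0}^{|v|} α^{-j} τ_{v|j}`. -/
def tLeaves (α : ℝ) (τ : TreeVertex → ℝ) (t : ℝ) : Set TreeVertex :=
  {v | pathTime α τ v v.length ≤ ENNReal.ofReal t ∧
    ENNReal.ofReal t < pathTime α τ v (v.length + 1)}

/-- The event `G_t` that zero or finitely many branches of the cascade `(α^{-|v|} T_v)` cross the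
horizon `t`. -/
def finiteCrossing {Ω : Type*} (α : ℝ) (T : TreeVertex → Ω → ℝ) (t : ℝ) : Set Ω :=
  {ω | (tLeaves α (fun v => T v ω) t).Finite}

end AlphaRiccati

/-!
Everything is read off from the Riccati equation satisfied by `w t`, the probability that the
horizon `t` is crossed infinitely often. Conditioning on the root clock, which is independent of the
two principal subtrees, themselves independent copies of the whole cascade (`map_graft`), gives

  `w t = ∫₀ᵗ e⁻ˢ (2 w - w ^ 2) (α (t - s)) ds`   (`IsBranching.prob_eq`).

The same map sends `qₙ t`, the probability of a leaf in generation `n` or later, to `qₙ₊₁ t`, and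
`qₙ` decreases to `w`.

* For `α ≤ 1` the map is a contraction in the norm with weight `e³ᵗ`, so `w = 0`.
* For `α > 1` the function `q₀` is integrable: a leaf at `t` forces some path sum to exceed `t`,
  and the supremum of all path sums has finite mean because the maximum of the `2 ^ j` clocks of
  generation `j` has mean `O(j)` and is weighted by `α ^ (-j)` (`mass_deepCrossing_zero_lt_top`).
  Integrating the equation over all horizons gives `α ∫ qₙ₊₁ = ∫ (2 qₙ - qₙ ^ 2)`, and likewise
  for `w` (`IsBranching.mul_mass`).
* For `α ≥ 2` this forces `∫ w ^ 2 = 0`, also in the critical case `α = 2`. Hence `w = 0` almost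
  everywhere, and then everywhere, since `w t ≤ (2 / α) ∫ w` by boundedness of the exponential
  density (`IsBranching.mul_prob_le_mass`).
* For `1 < α < 2`, if `w` vanished almost everywhere then `∫ qₙ → 0`, so `qₙ → 0` uniformly. But
  once `qₙ ≤ 2 - α` one has `2 qₙ - qₙ ^ 2 ≥ α qₙ`, so `∫ qₙ` stops decreasing, although it is
  never zero (`mass_infiniteCrossing_ne_zero`). Finally a single zero of `w` would propagate through
  the equation to the whole half-line (`prob_infiniteCrossing_ne_zero`).
-/

namespace AlphaRiccati

/-! ### Leaves of the tree and of its two principal subtrees -/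

/-- The clocks of the subtree rooted at the child `b` of the root. -/
def subtree (b : Bool) (τ : TreeVertex → ℝ) : TreeVertex → ℝ := fun v => τ (b :: v)

lemma pathTime_cons (α : ℝ) (τ : TreeVertex → ℝ) (b : Bool) (v : TreeVertex) (n : ℕ) :
    pathTime α τ (b :: v) (n + 1) =
      ENNReal.ofReal (τ []) + (ENNReal.ofReal α)⁻¹ * pathTime α (subtree b τ) v n := by
  simp only [pathTime, Finset.sum_range_succ', subtree, Finset.mul_sum]
  rw [add_comm]
  congr 1
  · simp
  · refine Finset.sum_congr rfl fun j _ => ?_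
    rw [← mul_assoc, ENNReal.inv_pow, ENNReal.inv_pow, pow_succ']
    simp

lemma nil_mem_tLeaves {α : ℝ} {τ : TreeVertex → ℝ} {t : ℝ} :
    [] ∈ tLeaves α τ t ↔ ENNReal.ofReal t < ENNReal.ofReal (τ []) := by
  simp [tLeaves, pathTime]

/-- After the root has branched at time `τ ∅`, each principal subtree is a cascade of the same kind
with the remaining horizon rescaled by `α`. For `α = 0` this remains true: the rescaled horizon is
`0` and `∞ * x ≤ t` means `x = 0`. -/
lemma cons_mem_tLeaves {α : ℝ} (hα : 0 ≤ α) {τ : TreeVertex → ℝ} (hτ : 0 < τ []) {t : ℝ}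
    {b : Bool} {v : TreeVertex} :
    b :: v ∈ tLeaves α τ t ↔ τ [] ≤ t ∧ v ∈ tLeaves α (subtree b τ) (α * (t - τ [])) := by
  by_cases h : τ [] ≤ t
  · have key : ∀ x : ℝ≥0∞, ENNReal.ofReal (τ []) + (ENNReal.ofReal α)⁻¹ * x ≤ ENNReal.ofReal t ↔
        x ≤ ENNReal.ofReal (α * (t - τ [])) := by
      intro x
      have ht : ENNReal.ofReal t = ENNReal.ofReal (τ []) + ENNReal.ofReal (t - τ []) := by
        rw [← ENNReal.ofReal_add hτ.le (by linarith)]; congr 1; ring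
      rw [ht, ENNReal.add_le_add_iff_left ENNReal.ofReal_ne_top, mul_comm, ← div_eq_mul_inv,
        ENNReal.div_le_iff_le_mul (Or.inr ENNReal.ofReal_ne_top) (Or.inl ENNReal.ofReal_ne_top),
        ENNReal.ofReal_mul hα, mul_comm]
    simp only [tLeaves, mem_ofPred_eq, List.length_cons, pathTime_cons, h, true_and, key,
      ← not_le]
  · simp only [h, false_and, iff_false]
    rintro ⟨h1, -⟩
    rw [List.length_cons, pathTime_cons] at h1
    have h2 := (le_self_add).trans h1
    rw [ENNReal.ofReal_le_ofReal_iff'] at h2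
    rcases h2 with h2 | h2
    · exact h h2
    · linarith

/-- The pairs (clocks, horizon) for which some leaf lies in generation `n` or later. -/
def deepCrossing (α : ℝ) (n : ℕ) : Set ((TreeVertex → ℝ) × ℝ) :=
  {p | ∃ v ∈ tLeaves α p.1 p.2, n ≤ v.length}

/-- The pairs (clocks, horizon) with infinitely many leaves. -/
def infiniteCrossing (α : ℝ) : Set ((TreeVertex → ℝ) × ℝ) :=
  {p | (tLeaves α p.1 p.2).Infinite}

lemma deepCrossing_antitone (α : ℝ) : Antitone (deepCrossing α) :=
  fun _ _ hmn _ ⟨v, hv, hn⟩ => ⟨v, hv, hmn.trans hn⟩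

/-- There are finitely many vertices below any generation, so infinitely many leaves means leaves
in arbitrarily late generations. -/
lemma infiniteCrossing_eq_iInter (α : ℝ) : infiniteCrossing α = ⋂ n, deepCrossing α n := by
  ext p
  simp only [infiniteCrossing, mem_ofPred_eq, mem_iInter, deepCrossing]
  constructor
  · intro h n
    obtain ⟨v, hv, hn⟩ := h.exists_notMem_finite (List.finite_length_lt Bool n)
    exact ⟨v, hv, by simpa using hn⟩
  · intro h hfin
    obtain ⟨N, hN⟩ := (hfin.image List.length).bddAbove
    obtain ⟨v, hv, hn⟩ := h (N + 1)
    have := hN (mem_image_of_mem _ hv)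
    omega

lemma measurable_pathTime (α : ℝ) (v : TreeVertex) (n : ℕ) :
    Measurable fun τ : TreeVertex → ℝ => pathTime α τ v n := by
  unfold pathTime
  fun_prop

lemma measurableSet_deepCrossing (α : ℝ) (n : ℕ) : MeasurableSet (deepCrossing α n) := by
  have : deepCrossing α n = ⋃ v : TreeVertex, ⋃ _ : n ≤ v.length,
      {p : (TreeVertex → ℝ) × ℝ | pathTime α p.1 v v.length ≤ ENNReal.ofReal p.2 ∧
        ENNReal.ofReal p.2 < pathTime α p.1 v (v.length + 1)} := by
    ext p
    simp only [deepCrossing, tLeaves, mem_ofPred_eq, mem_iUnion, exists_prop]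
    exact exists_congr fun v => and_comm
  rw [this]
  refine MeasurableSet.iUnion fun v => MeasurableSet.iUnion fun _ => ?_
  exact (measurableSet_le ((measurable_pathTime α v _).comp measurable_fst) (by fun_prop)).inter
    (measurableSet_lt (by fun_prop) ((measurable_pathTime α v _).comp measurable_fst))

lemma measurableSet_infiniteCrossing (α : ℝ) : MeasurableSet (infiniteCrossing α) := by
  rw [infiniteCrossing_eq_iInter]
  exact MeasurableSet.iInter fun n => measurableSet_deepCrossing α n

/-- `IsBranching α A A'` says that a cascade with horizon `t` belongs to `A'` exactly when its root
has branched by time `t` and one of the two principal subtrees, with the rescaled remaining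
horizon, belongs to `A`. -/
def IsBranching (α : ℝ) (A A' : Set ((TreeVertex → ℝ) × ℝ)) : Prop :=
  ∀ (τ : TreeVertex → ℝ) (t : ℝ), 0 < τ [] → ((τ, t) ∈ A' ↔ τ [] ≤ t ∧
    ((subtree false τ, α * (t - τ [])) ∈ A ∨ (subtree true τ, α * (t - τ [])) ∈ A))

lemma isBranching_deepCrossing {α : ℝ} (hα : 0 ≤ α) (n : ℕ) :
    IsBranching α (deepCrossing α n) (deepCrossing α (n + 1)) := by
  intro τ t hτ
  simp only [deepCrossing, mem_ofPred_eq]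
  constructor
  · rintro ⟨v, hv, hn⟩
    match v, hv, hn with
    | [], _, hn => simp at hn
    | b :: v, hv, hn =>
      rw [cons_mem_tLeaves hα hτ] at hv
      refine ⟨hv.1, ?_⟩
      have hn' : n ≤ v.length := by simpa using hn
      cases b
      · exact Or.inl ⟨v, hv.2, hn'⟩
      · exact Or.inr ⟨v, hv.2, hn'⟩
  · rintro ⟨ht, ⟨v, hv, hn⟩ | ⟨v, hv, hn⟩⟩
    · exact ⟨false :: v, (cons_mem_tLeaves hα hτ).2 ⟨ht, hv⟩, by simpa using hn⟩
    · exact ⟨true :: v, (cons_mem_tLeaves hα hτ).2 ⟨ht, hv⟩, by simpa using hn⟩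

lemma isBranching_infiniteCrossing {α : ℝ} (hα : 0 ≤ α) :
    IsBranching α (infiniteCrossing α) (infiniteCrossing α) := by
  intro τ t hτ
  have hsucc : (τ, t) ∈ infiniteCrossing α ↔ ∀ n, (τ, t) ∈ deepCrossing α (n + 1) := by
    rw [infiniteCrossing_eq_iInter, mem_iInter]
    exact ⟨fun h n => h _, fun h n => deepCrossing_antitone α n.le_succ (h n)⟩
  rw [hsucc]
  simp only [isBranching_deepCrossing hα _ τ t hτ]
  simp only [infiniteCrossing_eq_iInter, mem_iInter]
  constructor
  · intro h
    refine ⟨(h 0).1, ?_⟩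
    -- Antitonicity: a generation missed by each subtree gives one missed by both.
    by_contra! hcon
    obtain ⟨⟨m, hm⟩, k, hk⟩ := hcon
    rcases (h (max m k)).2 with h' | h'
    · exact hm (deepCrossing_antitone α (le_max_left _ _) h')
    · exact hk (deepCrossing_antitone α (le_max_right _ _) h')
  · rintro ⟨ht, h | h⟩ n
    · exact ⟨ht, Or.inl (h n)⟩
    · exact ⟨ht, Or.inr (h n)⟩

/-! ### The law of the clocks and the branching recursion -/

instance isProbabilityMeasure_expMeasure_one : IsProbabilityMeasure (expMeasure 1) :=
  isProbabilityMeasure_expMeasure one_pos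

/-- The law of the whole family of clocks: i.i.d. mean-one exponential variables. -/
noncomputable def clockLaw : Measure (TreeVertex → ℝ) := Measure.infinitePi fun _ => expMeasure 1

instance isProbabilityMeasure_clockLaw : IsProbabilityMeasure clockLaw := by
  unfold clockLaw; infer_instance

/-- The family of clocks with given root clock and given principal subtrees. -/
def graft (p : ℝ × (TreeVertex → ℝ) × (TreeVertex → ℝ)) : TreeVertex → ℝ
  | [] => p.1
  | false :: v => p.2.1 v
  | true :: v => p.2.2 v

lemma measurable_graft : Measurable graft := by
  refine measurable_pi_lambda _ fun v => ?_
  match v with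
  | [] => exact measurable_fst
  | false :: v => exact (measurable_pi_apply v).comp (measurable_fst.comp measurable_snd)
  | true :: v => exact (measurable_pi_apply v).comp (measurable_snd.comp measurable_snd)

/-- A finite product over vertices, split into the root and the two principal subtrees. -/
lemma prod_eq_root_mul_children (s : Finset TreeVertex) (f : TreeVertex → ℝ≥0∞) :
    ∏ v ∈ s, f v = (if [] ∈ s then f [] else 1) *
      ((∏ v ∈ s.preimage (List.cons false) List.cons_injective.injOn, f (false :: v)) *
        ∏ v ∈ s.preimage (List.cons true) List.cons_injective.injOn, f (true :: v)) := by
  classical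
  rw [Finset.prod_preimage' (List.cons false), Finset.prod_preimage' (List.cons true),
    Finset.prod_filter, Finset.prod_filter, ← Finset.prod_ite_eq' s [] f,
    ← Finset.prod_mul_distrib, ← Finset.prod_mul_distrib]
  refine Finset.prod_congr rfl fun v _ => ?_
  match v with
  | [] => simp
  | false :: v => simp
  | true :: v => simp

/-- The root clock and the two principal subtrees are independent, and each subtree has the law of
the whole tree. -/
lemma map_graft : ((expMeasure 1).prod (clockLaw.prod clockLaw)).map graft = clockLaw := by
  classical
  refine Measure.eq_infinitePi _ fun s t ht => ?_
  rw [Measure.map_apply measurable_graft (.pi s.countable_toSet fun i _ => ht i)]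
  have hpre : graft ⁻¹' (s : Set TreeVertex).pi t = (if [] ∈ s then t [] else univ) ×ˢ
      (((s.preimage (List.cons false) List.cons_injective.injOn : Finset TreeVertex) :
          Set TreeVertex).pi (fun v => t (false :: v)) ×ˢ
        ((s.preimage (List.cons true) List.cons_injective.injOn : Finset TreeVertex) :
          Set TreeVertex).pi fun v => t (true :: v)) := by
    ext p
    simp only [mem_preimage, Set.mem_pi, Finset.mem_coe, mem_prod, Finset.mem_preimage]
    constructor
    · intro h
      refine ⟨?_, fun v hv => h _ hv, fun v hv => h _ hv⟩
      split_ifs with h0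
      · exact h [] h0
      · trivial
    · rintro ⟨h0, h1, h2⟩ v hv
      match v, hv with
      | [], hv => rw [if_pos hv] at h0; exact h0
      | false :: v, hv => exact h1 v hv
      | true :: v, hv => exact h2 v hv
  rw [hpre, Measure.prod_prod, Measure.prod_prod, prod_eq_root_mul_children]
  unfold clockLaw
  rw [Measure.infinitePi_pi _ fun i _ => ht _, Measure.infinitePi_pi _ fun i _ => ht _]
  congr 1
  split_ifs <;> simp

lemma expMeasure_one_eq : expMeasure 1 = volume.withDensity (exponentialPDF 1) := rfl

lemma measurable_exponentialPDF (r : ℝ) : Measurable (exponentialPDF r) :=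
  (measurable_exponentialPDFReal r).ennreal_ofReal

lemma ae_pos_expMeasure_one : ∀ᵐ s ∂expMeasure 1, 0 < s := by
  rw [expMeasure_one_eq, ae_withDensity_iff (measurable_exponentialPDF 1)]
  filter_upwards [Measure.ae_ne volume (0 : ℝ)] with s hs hpdf
  by_contra! h
  exact hpdf (exponentialPDF_of_neg (lt_of_le_of_ne h hs))

lemma expMeasure_one_le_volume : expMeasure 1 ≤ volume := by
  rw [expMeasure_one_eq]
  conv_rhs => rw [← withDensity_one (μ := (volume : Measure ℝ))]
  refine withDensity_mono (Filter.Eventually.of_forall fun s => ?_)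
  rcases lt_or_ge s 0 with hs | hs
  · simp [exponentialPDF_of_neg hs]
  · rw [exponentialPDF_of_nonneg hs]
    simpa using hs

/-- Exponential moments of the mean-one exponential law. The integrand times the density is a
multiple of the density of rate `1 - c`. -/
lemma lintegral_exp_mul_expMeasure_one {c : ℝ} (hc : c < 1) :
    ∫⁻ s, ENNReal.ofReal (Real.exp (c * s)) ∂expMeasure 1 = ENNReal.ofReal (1 - c)⁻¹ := by
  have h1 : 0 < 1 - c := by linarith
  rw [expMeasure_one_eq, lintegral_withDensity_eq_lintegral_mul _ (measurable_exponentialPDF 1)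
    (by fun_prop)]
  have : ∀ s, (exponentialPDF 1 * fun s => ENNReal.ofReal (Real.exp (c * s))) s =
      ENNReal.ofReal (1 - c)⁻¹ * exponentialPDF (1 - c) s := by
    intro s
    rw [Pi.mul_apply]
    rcases lt_or_ge s 0 with hs | hs
    · simp [exponentialPDF_of_neg hs]
    · have hexp : Real.exp (-(1 * s)) * Real.exp (c * s) = Real.exp (-((1 - c) * s)) := by
        rw [← Real.exp_add]; congr 1; ring
      rw [exponentialPDF_of_nonneg hs, exponentialPDF_of_nonneg hs,
        ← ENNReal.ofReal_mul (by positivity), ← ENNReal.ofReal_mul (by positivity), one_mul,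
        hexp, inv_mul_cancel_left₀ h1.ne']
  simp_rw [this]
  rw [lintegral_const_mul _ (measurable_exponentialPDF _), lintegral_exponentialPDF_eq_one h1,
    mul_one]

/-- The probability that the cascade with horizon `t` belongs to `A`. -/
noncomputable def prob (A : Set ((TreeVertex → ℝ) × ℝ)) (t : ℝ) : ℝ≥0∞ :=
  clockLaw {τ | (τ, t) ∈ A}

/-- The probability that at least one of two independent cascades with horizon `t` belongs to
`A`. -/
noncomputable def probEither (A : Set ((TreeVertex → ℝ) × ℝ)) (t : ℝ) : ℝ≥0∞ :=
  (clockLaw.prod clockLaw) {σ | (σ.1, t) ∈ A ∨ (σ.2, t) ∈ A}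

variable {A A' : Set ((TreeVertex → ℝ) × ℝ)} {α : ℝ}

lemma measurable_prob (hA : MeasurableSet A) : Measurable (prob A) :=
  measurable_measure_prodMk_right hA

lemma measurable_probEither (hA : MeasurableSet A) : Measurable (probEither A) := by
  have : MeasurableSet {p : ((TreeVertex → ℝ) × (TreeVertex → ℝ)) × ℝ |
      (p.1.1, p.2) ∈ A ∨ (p.1.2, p.2) ∈ A} :=
    (hA.preimage (by fun_prop : Measurable fun p : ((TreeVertex → ℝ) × (TreeVertex → ℝ)) × ℝ =>
      (p.1.1, p.2))).union
    (hA.preimage (by fun_prop : Measurable fun p : ((TreeVertex → ℝ) × (TreeVertex → ℝ)) × ℝ =>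
      (p.1.2, p.2)))
  exact measurable_measure_prodMk_right this

lemma prob_le_one (A : Set ((TreeVertex → ℝ) × ℝ)) (t : ℝ) : prob A t ≤ 1 :=
  MeasureTheory.prob_le_one

/-- Inclusion-exclusion: `probEither = 2 prob - prob ^ 2`, the Riccati nonlinearity. -/
lemma probEither_add_sq (hA : MeasurableSet A) (t : ℝ) :
    probEither A t + prob A t * prob A t = 2 * prob A t := by
  have hm : MeasurableSet {τ | (τ, t) ∈ A} := hA.preimage (by fun_prop)
  have h1 := measure_union_add_inter (μ := clockLaw.prod clockLaw)
    ({τ | (τ, t) ∈ A} ×ˢ univ) (MeasurableSet.univ.prod hm)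
  have e1 : {τ | (τ, t) ∈ A} ×ˢ univ ∪ univ ×ˢ {τ | (τ, t) ∈ A} =
      {σ : (TreeVertex → ℝ) × (TreeVertex → ℝ) | (σ.1, t) ∈ A ∨ (σ.2, t) ∈ A} := by
    ext σ; simp
  have e2 : ({τ | (τ, t) ∈ A} ×ˢ univ ∩ univ ×ˢ {τ | (τ, t) ∈ A} :
      Set ((TreeVertex → ℝ) × (TreeVertex → ℝ))) = {τ | (τ, t) ∈ A} ×ˢ {τ | (τ, t) ∈ A} := by
    ext σ; simp
  rw [e1, e2, Measure.prod_prod, Measure.prod_prod, Measure.prod_prod, measure_univ, mul_one,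
    one_mul, ← two_mul] at h1
  exact h1

lemma probEither_le (hA : MeasurableSet A) (t : ℝ) : probEither A t ≤ 2 * prob A t :=
  le_self_add.trans (probEither_add_sq hA t).le

lemma prob_le_probEither (A : Set ((TreeVertex → ℝ) × ℝ)) (t : ℝ) : prob A t ≤ probEither A t := by
  calc prob A t = (clockLaw.prod clockLaw) ({τ | (τ, t) ∈ A} ×ˢ univ) := by
        rw [Measure.prod_prod, measure_univ, mul_one]; rfl
    _ ≤ probEither A t := measure_mono fun σ hσ => Or.inl hσ.1

/-- If `prob A t ≤ 2 - α` then `2 prob - prob ^ 2 ≥ α prob`: small probabilities grow under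
branching. -/
lemma mul_prob_le_probEither (hA : MeasurableSet A) {t : ℝ} (hα : 0 ≤ α)
    (h : prob A t ≤ ENNReal.ofReal (2 - α)) (hα2 : α ≤ 2) :
    ENNReal.ofReal α * prob A t ≤ probEither A t := by
  have hfin : prob A t * prob A t ≠ ⊤ :=
    ENNReal.mul_ne_top (measure_ne_top _ _) (measure_ne_top _ _)
  refine (ENNReal.add_le_add_iff_right hfin).1 ?_
  rw [probEither_add_sq hA, ← add_mul]
  gcongr
  calc ENNReal.ofReal α + prob A t ≤ ENNReal.ofReal α + ENNReal.ofReal (2 - α) := by gcongr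
    _ = 2 := by rw [← ENNReal.ofReal_add hα (by linarith)]; norm_num

/-- The integral form of the Riccati equation, obtained by conditioning on the root clock. -/
lemma IsBranching.prob_eq (h : IsBranching α A A') (hA' : MeasurableSet A') (t : ℝ) :
    prob A' t =
      ∫⁻ s, (Iic t).indicator (fun s => probEither A (α * (t - s))) s ∂expMeasure 1 := by
  have hm : MeasurableSet {τ | (τ, t) ∈ A'} := hA'.preimage (by fun_prop)
  rw [prob, ← map_graft, Measure.map_apply measurable_graft hm,
    Measure.prod_apply (hm.preimage measurable_graft)]
  refine lintegral_congr_ae ?_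
  filter_upwards [ae_pos_expMeasure_one] with s hs
  have hsec : Prod.mk s ⁻¹' (graft ⁻¹' {τ | (τ, t) ∈ A'}) = {σ | s ≤ t ∧
      ((σ.1, α * (t - s)) ∈ A ∨ (σ.2, α * (t - s)) ∈ A)} := by
    ext σ
    exact h (graft (s, σ)) t hs
  rw [hsec]
  by_cases hst : s ≤ t
  · simp [hst, probEither]
  · simp [hst]

lemma IsBranching.prob_le (h : IsBranching α A A') (hA : MeasurableSet A)
    (hA' : MeasurableSet A') (t : ℝ) :
    prob A' t ≤ ∫⁻ s, (Iic t).indicator (fun s => 2 * prob A (α * (t - s))) s ∂expMeasure 1 := by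
  rw [h.prob_eq hA']
  exact lintegral_mono fun s => indicator_le_indicator (probEither_le hA _)

/-! ### The mass of a solution of the recursion -/

/-- The total mass `∫₀^∞ ℙ((τ, t) ∈ A) dt`. -/
noncomputable def mass (A : Set ((TreeVertex → ℝ) × ℝ)) : ℝ≥0∞ := ∫⁻ t in Ici 0, prob A t

lemma ofReal_mul_lintegral_comp_mul (hα : 0 < α) {f : ℝ → ℝ≥0∞} (hf : Measurable f) :
    ENNReal.ofReal α * ∫⁻ r, (Ici 0).indicator (fun r => f (α * r)) r = ∫⁻ t in Ici 0, f t := by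
  have hm : Measurable ((Ici (0 : ℝ)).indicator f) := hf.indicator measurableSet_Ici
  rw [← lintegral_indicator measurableSet_Ici]
  conv_rhs => rw [← Real.smul_map_volume_mul_left hα.ne']
  rw [lintegral_smul_measure, lintegral_map hm (by fun_prop), abs_of_pos hα, smul_eq_mul]
  congr 1
  refine lintegral_congr fun r => ?_
  by_cases hr : 0 ≤ r
  · simp [hr, mul_nonneg hα.le hr]
  · have : ¬ 0 ≤ α * r := by simpa [mul_nonneg_iff_of_pos_left hα] using hr
    rw [indicator_of_notMem (by exact hr), indicator_of_notMem (by exact this)]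

lemma indicator_Iic_eq (f : ℝ → ℝ≥0∞) (s t : ℝ) :
    (Iic t).indicator (fun s => f (α * (t - s))) s =
      (Ici 0).indicator (fun r => f (α * r)) (t - s) := by
  by_cases h : s ≤ t
  · rw [indicator_of_mem (by exact h), indicator_of_mem (by simpa using h)]
  · rw [indicator_of_notMem (by exact h), indicator_of_notMem (by simpa using h)]

/-- Integrating the Riccati equation over all horizons: the exponential kernel has mass one, and
rescaling the horizon by `α` divides the mass by `α`. -/
lemma IsBranching.mul_mass (h : IsBranching α A A') (hα : 0 < α) (hA : MeasurableSet A)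
    (hA' : MeasurableSet A') :
    ENNReal.ofReal α * mass A' = ∫⁻ t in Ici 0, probEither A t := by
  have hu := measurable_probEither hA
  have hF : Measurable fun p : ℝ × ℝ =>
      (Ici (0 : ℝ)).indicator (fun r => probEither A (α * r)) (p.1 - p.2) :=
    ((hu.comp (measurable_const_mul α)).indicator measurableSet_Ici).comp
      (measurable_fst.sub measurable_snd)
  have : mass A' = ∫⁻ r, (Ici 0).indicator (fun r => probEither A (α * r)) r := by
    simp_rw [mass, h.prob_eq hA', indicator_Iic_eq]
    rw [lintegral_lintegral_swap hF.aemeasurable]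
    calc _ = ∫⁻ _, (∫⁻ r, (Ici 0).indicator (fun r => probEither A (α * r)) r) ∂expMeasure 1 := by
          refine lintegral_congr_ae ?_
          filter_upwards [ae_pos_expMeasure_one] with s hs
          rw [← lintegral_sub_right_eq_self
            ((Ici 0).indicator fun r => probEither A (α * r)) s,
            ← lintegral_indicator measurableSet_Ici]
          refine lintegral_congr fun t => ?_
          by_cases ht : 0 ≤ t
          · rw [indicator_of_mem (by exact ht)]
          · have hts : ¬ 0 ≤ t - s := by linarith
            rw [indicator_of_notMem (s := Ici 0) (a := t) ht,
              indicator_of_notMem (s := Ici 0) (a := t - s) hts]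
      _ = _ := by simp
  rw [this, ofReal_mul_lintegral_comp_mul hα hu]

/-- The exponential density is bounded by one, so the mass controls the next iterate uniformly. -/
lemma IsBranching.mul_prob_le_mass (h : IsBranching α A A') (hα : 0 < α) (hA : MeasurableSet A)
    (hA' : MeasurableSet A') (t : ℝ) : ENNReal.ofReal α * prob A' t ≤ 2 * mass A := by
  have hp := (measurable_prob hA).const_mul 2
  calc ENNReal.ofReal α * prob A' t
      ≤ ENNReal.ofReal α *
          ∫⁻ s, (Iic t).indicator (fun s => 2 * prob A (α * (t - s))) s ∂expMeasure 1 := by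
        gcongr
        exact h.prob_le hA hA' t
    _ ≤ ENNReal.ofReal α * ∫⁻ s, (Iic t).indicator (fun s => 2 * prob A (α * (t - s))) s := by
        gcongr
        exact expMeasure_one_le_volume
    _ = ENNReal.ofReal α * ∫⁻ r, (Ici 0).indicator (fun r => 2 * prob A (α * r)) r := by
        congr 1
        simp_rw [indicator_Iic_eq fun r => 2 * prob A r]
        exact lintegral_sub_left_eq_self ((Ici 0).indicator fun r => 2 * prob A (α * r)) t
    _ = 2 * mass A := by
        rw [ofReal_mul_lintegral_comp_mul hα hp, mass, lintegral_const_mul _ (measurable_prob hA)]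

/-! ### Crossings occur with integrable probability when `α > 1` -/

/-- A bound for every path sum: in generation `j` each clock is at most
`2 j + 2 * 2 ^ (-j) * ∑ exp (τ_v / 2)`, the sum being over the `2 ^ j` vertices of that
generation; the mean of this bound is `2 j + 4`. -/
noncomputable def heightBound (α : ℝ) (τ : TreeVertex → ℝ) : ℝ≥0∞ :=
  ∑' j : ℕ, (ENNReal.ofReal α ^ j)⁻¹ * (2 * j + 2 * (2⁻¹ ^ j *
    ∑ w : List.Vector Bool j, ENNReal.ofReal (Real.exp (1 / 2 * τ w.toList))))

lemma ofReal_le_exp_bound (x : ℝ) (j : ℕ) :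
    ENNReal.ofReal x ≤ 2 * j + 2 * (2⁻¹ ^ j * ENNReal.ofReal (Real.exp (1 / 2 * x))) := by
  have h2 : (2 : ℝ)⁻¹ ^ j = Real.exp (-(j * Real.log 2)) := by
    rw [Real.exp_neg, Real.exp_nat_mul, Real.exp_log two_pos, inv_pow]
  have hlog : Real.log 2 ≤ 1 := by have := Real.log_two_lt_d9; linarith
  have hreal : x ≤ 2 * j + 2 * ((2 : ℝ)⁻¹ ^ j * Real.exp (1 / 2 * x)) := by
    rw [h2, ← Real.exp_add]
    -- `y + 1 ≤ exp y` at `y = x / 2 - j log 2`.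
    have h3 := Real.add_one_le_exp (-(j * Real.log 2) + 1 / 2 * x)
    have h4 : (j : ℝ) * Real.log 2 ≤ j := mul_le_of_le_one_right (Nat.cast_nonneg j) hlog
    linarith
  refine (ENNReal.ofReal_le_ofReal hreal).trans_eq ?_
  rw [ENNReal.ofReal_add (by positivity) (by positivity), ENNReal.ofReal_mul two_pos.le,
    ENNReal.ofReal_mul two_pos.le, ENNReal.ofReal_mul (by positivity),
    ENNReal.ofReal_pow (by positivity), ENNReal.ofReal_inv_of_pos two_pos]
  simp

lemma pathTime_le_heightBound (α : ℝ) (τ : TreeVertex → ℝ) (v : TreeVertex) :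
    pathTime α τ v (v.length + 1) ≤ heightBound α τ := by
  unfold pathTime heightBound
  refine le_trans (Finset.sum_le_sum fun j hj => ?_) (ENNReal.sum_le_tsum _)
  have hlen : (v.take j).length = j := by
    rw [List.length_take]; have := Finset.mem_range.1 hj; omega
  gcongr
  refine (ofReal_le_exp_bound _ j).trans ?_
  gcongr
  exact Finset.single_le_sum (f := fun w : List.Vector Bool j =>
    ENNReal.ofReal (Real.exp (1 / 2 * τ w.toList))) (fun _ _ => zero_le)
    (Finset.mem_univ ⟨v.take j, hlen⟩)

lemma lintegral_heightBound_lt_top (hα : 1 < α) : ∫⁻ τ, heightBound α τ ∂clockLaw < ⊤ := by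
  have hα0 : 0 < α := by linarith
  have hint : ∫⁻ τ, heightBound α τ ∂clockLaw =
      ∑' j : ℕ, (ENNReal.ofReal α ^ j)⁻¹ * (2 * j + 2 * 2) := by
    unfold heightBound
    rw [lintegral_tsum fun j => (by fun_prop :
      Measurable fun τ : TreeVertex → ℝ => (ENNReal.ofReal α ^ j)⁻¹ * (2 * j + 2 * (2⁻¹ ^ j *
        ∑ w : List.Vector Bool j, ENNReal.ofReal (Real.exp (1 / 2 * τ w.toList))))).aemeasurable]
    refine tsum_congr fun j => ?_
    rw [lintegral_const_mul _ (by fun_prop), lintegral_add_left (by fun_prop), lintegral_const,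
      lintegral_const_mul _ (by fun_prop), lintegral_const_mul _ (by fun_prop),
      lintegral_finsetSum _ (fun w _ => by fun_prop)]
    have hw : ∀ w : List.Vector Bool j,
        ∫⁻ τ, ENNReal.ofReal (Real.exp (1 / 2 * τ w.toList)) ∂clockLaw = 2 := by
      intro w
      refine ((measurePreserving_eval_infinitePi (fun _ : TreeVertex => expMeasure 1)
        w.toList).lintegral_comp (f := fun s => ENNReal.ofReal (Real.exp (1 / 2 * s)))
        (by fun_prop)).trans ?_
      rw [lintegral_exp_mul_expMeasure_one (by norm_num)]
      norm_num
    simp only [hw, Finset.sum_const, Finset.card_univ, card_vector, Fintype.card_bool,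
      measure_univ, mul_one, nsmul_eq_mul, Nat.cast_pow, Nat.cast_ofNat]
    rw [← mul_assoc (2⁻¹ ^ j), ← mul_pow, ENNReal.inv_mul_cancel two_ne_zero ENNReal.ofNat_ne_top,
      one_pow, one_mul]
  rw [hint]
  have hr : ‖α⁻¹‖ < 1 := by
    rw [Real.norm_eq_abs, abs_of_pos (inv_pos.2 hα0)]
    exact inv_lt_one_of_one_lt₀ hα
  have hs : Summable fun j : ℕ => (2 * j + 4 : ℝ) * α⁻¹ ^ j := by
    have h1 := (summable_pow_mul_geometric_of_norm_lt_one 1 hr).mul_left 2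
    have h2 := (summable_geometric_of_norm_lt_one hr).mul_left 4
    refine (h1.add h2).congr fun j => ?_
    ring
  refine lt_of_eq_of_lt (tsum_congr fun j => ?_) hs.tsum_ofReal_lt_top
  rw [mul_comm (2 * (j : ℝ) + 4), ENNReal.ofReal_mul (by positivity),
    ENNReal.ofReal_pow (by positivity), ENNReal.ofReal_inv_of_pos hα0, ENNReal.inv_pow,
    ENNReal.ofReal_add (by positivity) (by positivity), ENNReal.ofReal_mul two_pos.le]
  norm_num

lemma mass_deepCrossing_zero_lt_top (hα : 1 < α) : mass (deepCrossing α 0) < ⊤ := by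
  refine lt_of_le_of_lt ?_ (lintegral_heightBound_lt_top hα)
  have hm := measurableSet_deepCrossing α 0
  have hsec : ∀ t, prob (deepCrossing α 0) t =
      ∫⁻ τ, (deepCrossing α 0).indicator 1 (τ, t) ∂clockLaw := fun t => by
    exact (lintegral_indicator_one (hm.preimage (by fun_prop :
      Measurable fun τ : TreeVertex → ℝ => (τ, t)))).symm
  simp_rw [mass, hsec]
  rw [lintegral_lintegral_swap (by
    exact ((measurable_one.indicator hm).comp (measurable_snd.prodMk measurable_fst)).aemeasurable)]
  refine lintegral_mono fun τ => ?_
  by_cases htop : heightBound α τ = ⊤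
  · simp [htop]
  calc ∫⁻ t in Ici 0, (deepCrossing α 0).indicator 1 (τ, t)
      ≤ ∫⁻ t in Ici 0, (Iio (heightBound α τ).toReal).indicator 1 t := by
        refine lintegral_mono fun t => ?_
        by_cases ht : (τ, t) ∈ deepCrossing α 0
        · obtain ⟨v, hv, -⟩ := ht
          have hlt : t < (heightBound α τ).toReal := by
            by_contra! hle
            have := ENNReal.ofReal_le_ofReal hle
            rw [ENNReal.ofReal_toReal htop] at this
            exact (hv.2.trans_le (pathTime_le_heightBound α τ v)).not_ge this
          rw [indicator_of_mem (s := Iio _) (by exact hlt)]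
          exact indicator_le_self' (fun _ _ => zero_le_one) _
        · rw [indicator_of_notMem ht]
          exact zero_le
    _ = volume (Iio (heightBound α τ).toReal ∩ Ici 0) := by
        rw [lintegral_indicator_one measurableSet_Iio, Measure.restrict_apply measurableSet_Iio]
    _ ≤ heightBound α τ := by
        rw [Iio_inter_Ici, Real.volume_Ico, sub_zero, ENNReal.ofReal_toReal htop]

/-! ### Finitely many crossings for `α ≤ 1` and for `α ≥ 2` -/

/-- For `α ≤ 1` the recursion contracts by `1 / 2` in the norm with weight `exp (3 t)`. -/
lemma prob_infiniteCrossing_le_of_le_one (hα : 0 ≤ α) (hα1 : α ≤ 1) (n : ℕ) {t : ℝ} (ht : 0 ≤ t) :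
    prob (infiniteCrossing α) t ≤ ENNReal.ofReal ((1 / 2) ^ n * Real.exp (3 * t)) := by
  induction n generalizing t with
  | zero =>
    refine (prob_le_one _ t).trans ?_
    rw [pow_zero, one_mul, ENNReal.one_le_ofReal]
    exact Real.one_le_exp (by positivity)
  | succ n ih =>
    have hm := measurableSet_infiniteCrossing α
    refine ((isBranching_infiniteCrossing hα).prob_le hm hm t).trans ?_
    calc ∫⁻ s, (Iic t).indicator
            (fun s => 2 * prob (infiniteCrossing α) (α * (t - s))) s ∂expMeasure 1
        ≤ ∫⁻ s, ENNReal.ofReal (2 * ((1 / 2) ^ n * Real.exp (3 * t))) *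
            ENNReal.ofReal (Real.exp (-3 * s)) ∂expMeasure 1 := by
          refine lintegral_mono fun s => ?_
          by_cases hs : s ∈ Iic t
          swap
          · rw [indicator_of_notMem hs]
            exact zero_le
          rw [indicator_of_mem hs]
          have hst : 0 ≤ t - s := sub_nonneg.2 hs
          rw [← ENNReal.ofReal_mul (by positivity), mul_assoc, ENNReal.ofReal_mul two_pos.le,
            ENNReal.ofReal_ofNat]
          gcongr
          refine (ih (mul_nonneg hα hst)).trans (ENNReal.ofReal_le_ofReal ?_)
          rw [mul_assoc, ← Real.exp_add]
          gcongr
          -- `α (t - s) ≤ t - s`, and the weight `exp (3 (t - s))` leaves the factor `exp (-3 s)`.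
          nlinarith
      _ = ENNReal.ofReal ((1 / 2) ^ (n + 1) * Real.exp (3 * t)) := by
          rw [lintegral_const_mul _ (by fun_prop), lintegral_exp_mul_expMeasure_one (by norm_num),
            ← ENNReal.ofReal_mul (by positivity)]
          congr 1
          ring

lemma prob_infiniteCrossing_eq_zero_of_le_one (hα : 0 ≤ α) (hα1 : α ≤ 1) {t : ℝ} (ht : 0 ≤ t) :
    prob (infiniteCrossing α) t = 0 := by
  have hlim : Filter.Tendsto (fun n : ℕ => ENNReal.ofReal ((1 / 2) ^ n * Real.exp (3 * t)))
      Filter.atTop (nhds 0) := by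
    have := (tendsto_pow_atTop_nhds_zero_of_lt_one (r := (1 / 2 : ℝ)) (by norm_num)
      (by norm_num)).mul_const (Real.exp (3 * t))
    simpa using ENNReal.tendsto_ofReal this
  exact le_antisymm
    (ge_of_tendsto' hlim fun n => prob_infiniteCrossing_le_of_le_one hα hα1 n ht) zero_le

lemma prob_infiniteCrossing_le_deepCrossing (α : ℝ) (n : ℕ) (t : ℝ) :
    prob (infiniteCrossing α) t ≤ prob (deepCrossing α n) t := by
  refine measure_mono fun τ hτ => ?_
  rw [mem_ofPred_eq, infiniteCrossing_eq_iInter] at hτ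
  exact mem_iInter.1 hτ n

/-- With `w = prob (infiniteCrossing α)`, integrating the Riccati equation gives
`α ∫ w + ∫ w ^ 2 = 2 ∫ w < ∞`, which for `α ≥ 2` leaves no room for `∫ w ^ 2`. -/
lemma prob_infiniteCrossing_eq_zero_of_two_le (hα : 2 ≤ α) (t : ℝ) :
    prob (infiniteCrossing α) t = 0 := by
  have hα0 : 0 < α := by linarith
  have hm := measurableSet_infiniteCrossing α
  have hp := measurable_prob hm
  have hbr := isBranching_infiniteCrossing hα0.le
  have hfin : mass (infiniteCrossing α) ≠ ⊤ :=
    ((lintegral_mono fun t => prob_infiniteCrossing_le_deepCrossing α 0 t).trans_lt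
      (mass_deepCrossing_zero_lt_top (by linarith))).ne
  have hsum : ENNReal.ofReal α * mass (infiniteCrossing α) +
      ∫⁻ t in Ici 0, prob (infiniteCrossing α) t * prob (infiniteCrossing α) t =
        2 * mass (infiniteCrossing α) := by
    rw [hbr.mul_mass hα0 hm hm, ← lintegral_add_left (measurable_probEither hm), mass,
      ← lintegral_const_mul _ hp]
    exact lintegral_congr fun t => probEither_add_sq hm t
  have hsq : ∫⁻ t in Ici 0, prob (infiniteCrossing α) t * prob (infiniteCrossing α) t = 0 := by
    have h2 : (2 : ℝ≥0∞) ≤ ENNReal.ofReal α := by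
      rw [← ENNReal.ofReal_ofNat]; exact ENNReal.ofReal_le_ofReal hα
    have h2fin : 2 * mass (infiniteCrossing α) ≠ ⊤ := ENNReal.mul_ne_top (by simp) hfin
    refine le_antisymm ((ENNReal.add_le_add_iff_left h2fin).1 ?_) zero_le
    rw [add_zero]
    conv_rhs => rw [← hsum]
    gcongr
  have hmass : mass (infiniteCrossing α) = 0 := by
    rw [lintegral_eq_zero_iff (by fun_prop)] at hsq
    rw [mass, lintegral_eq_zero_iff hp]
    filter_upwards [hsq] with s hs
    simpa using hs
  have h0 := hbr.mul_prob_le_mass hα0 hm hm t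
  rw [hmass, mul_zero, nonpos_iff_eq_zero, mul_eq_zero] at h0
  exact h0.resolve_left (by simpa using hα0)

/-! ### Infinitely many crossings for `1 < α < 2` -/

lemma tendsto_prob_deepCrossing (α t : ℝ) :
    Filter.Tendsto (fun n => prob (deepCrossing α n) t) Filter.atTop
      (nhds (prob (infiniteCrossing α) t)) := by
  have h := tendsto_measure_iInter_atTop (μ := clockLaw)
    (s := fun n => {τ | (τ, t) ∈ deepCrossing α n})
    (fun n => ((measurableSet_deepCrossing α n).preimage
      (by fun_prop : Measurable fun τ : TreeVertex → ℝ => (τ, t))).nullMeasurableSet)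
    (fun m n hmn τ hτ => deepCrossing_antitone α hmn hτ) ⟨0, measure_ne_top _ _⟩
  have heq : ⋂ n, {τ | (τ, t) ∈ deepCrossing α n} = {τ | (τ, t) ∈ infiniteCrossing α} := by
    ext τ
    simp [infiniteCrossing_eq_iInter]
  rw [heq] at h
  exact h

/-- Every iterate has positive mass: the root itself is a leaf with positive probability, and each
step of the recursion multiplies the mass at least by `1 / α`. -/
lemma mass_deepCrossing_ne_zero (hα : 1 < α) (n : ℕ) : mass (deepCrossing α n) ≠ 0 := by
  have hα0 : 0 < α := by linarith
  induction n with
  | zero =>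
    intro h0
    rw [mass, lintegral_eq_zero_iff (measurable_prob (measurableSet_deepCrossing α 0))] at h0
    have hroot : ∀ t, expMeasure 1 (Ioi t) ≤ prob (deepCrossing α 0) t ∨ t < 0 := by
      intro t
      by_cases ht : t < 0
      · exact Or.inr ht
      left
      rw [← Measure.infinitePi_map_eval (fun _ : TreeVertex => expMeasure 1) [],
        Measure.map_apply (by fun_prop) measurableSet_Ioi]
      refine measure_mono fun τ hτ => ⟨[], nil_mem_tLeaves.2 ?_, le_rfl⟩
      exact (ENNReal.ofReal_lt_ofReal_iff_of_nonneg (not_lt.1 ht)).2 hτ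
    have hpos : ∀ t, 0 ≤ t → expMeasure 1 (Ioi t) ≠ 0 := by
      intro t ht h
      rw [expMeasure_one_eq, withDensity_apply_eq_zero (measurable_exponentialPDF 1)] at h
      have hsub : Ioi t ⊆ {x | exponentialPDF 1 x ≠ 0} ∩ Ioi t := fun x hx =>
        ⟨(ENNReal.ofReal_pos.2 (exponentialPDFReal_pos one_pos (ht.trans_lt hx))).ne', hx⟩
      have := measure_mono_null hsub h
      simp at this
    rw [Filter.EventuallyEq, ae_restrict_iff' measurableSet_Ici] at h0
    have hfalse : ∀ᵐ t : ℝ, t ∉ Ici (0 : ℝ) := by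
      filter_upwards [h0] with t ht htI
      rcases hroot t with h | h
      · exact hpos t htI (le_antisymm (h.trans (ht htI).le) zero_le)
      · exact absurd htI (not_le.2 h)
    have : volume (Ici (0 : ℝ)) = 0 := by
      rw [measure_eq_zero_iff_ae_notMem]
      exact hfalse
    simp at this
  | succ n ih =>
    intro h0
    have hbr := (isBranching_deepCrossing hα0.le n).mul_mass hα0
      (measurableSet_deepCrossing α n) (measurableSet_deepCrossing α (n + 1))
    rw [h0, mul_zero] at hbr
    refine ih (le_antisymm ?_ zero_le)
    rw [hbr]
    exact lintegral_mono fun t => prob_le_probEither _ t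

/-- If infinitely many crossings had zero mass, the masses of the events `deepCrossing α n` would
tend to zero; the probabilities would then tend to zero uniformly, and once they are below `2 - α`
the recursion no longer decreases the mass. -/
lemma mass_infiniteCrossing_ne_zero (hα : 1 < α) (hα2 : α < 2) :
    mass (infiniteCrossing α) ≠ 0 := by
  intro h0
  have hα0 : 0 < α := by linarith
  have hmeas := measurableSet_deepCrossing α
  have hlim : Filter.Tendsto (fun n => mass (deepCrossing α n)) Filter.atTop (nhds 0) := by
    rw [← h0]
    exact lintegral_tendsto_of_tendsto_of_antitone
      (fun n => (measurable_prob (hmeas n)).aemeasurable)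
      (Filter.Eventually.of_forall fun t m n hmn =>
        measure_mono fun τ hτ => deepCrossing_antitone α hmn hτ)
      (mass_deepCrossing_zero_lt_top hα).ne
      (Filter.Eventually.of_forall fun t => tendsto_prob_deepCrossing α t)
  -- Below this mass, `α qₙ₊₁ ≤ 2 ∫ qₙ` forces `qₙ₊₁ ≤ 2 - α` everywhere.
  have hδ : 0 < ENNReal.ofReal α * ENNReal.ofReal (2 - α) / 2 := by
    refine ENNReal.div_pos (mul_ne_zero ?_ ?_) (by simp) <;> simp <;> linarith
  obtain ⟨N, hN⟩ := Filter.eventually_atTop.1 (hlim.eventually_lt_const hδ)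
  have hαne : ENNReal.ofReal α ≠ 0 := by simpa using hα0
  have hsmall : ∀ n, N ≤ n → ∀ t, prob (deepCrossing α (n + 1)) t ≤ ENNReal.ofReal (2 - α) := by
    intro n hn t
    refine (ENNReal.mul_le_mul_iff_right hαne ENNReal.ofReal_ne_top).1 ?_
    refine ((isBranching_deepCrossing hα0.le n).mul_prob_le_mass hα0 (hmeas n)
      (hmeas (n + 1)) t).trans ?_
    rw [mul_comm]
    exact ENNReal.mul_le_of_le_div (hN n hn).le
  have hmono : ∀ k, mass (deepCrossing α (N + 1)) ≤ mass (deepCrossing α (N + 1 + k)) := by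
    intro k
    induction k with
    | zero => exact le_rfl
    | succ k ih =>
      refine ih.trans ?_
      refine (ENNReal.mul_le_mul_iff_right hαne ENNReal.ofReal_ne_top).1 ?_
      rw [← add_assoc, (isBranching_deepCrossing hα0.le (N + 1 + k)).mul_mass hα0 (hmeas _)
        (hmeas _), mass, ← lintegral_const_mul _ (measurable_prob (hmeas _))]
      refine lintegral_mono fun t => ?_
      refine mul_prob_le_probEither (hmeas _) hα0.le ?_ hα2.le
      have := hsmall (N + k) (by omega) t
      rwa [show N + k + 1 = N + 1 + k by omega] at this
  refine mass_deepCrossing_ne_zero hα (N + 1) (le_antisymm ?_ zero_le)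
  exact ge_of_tendsto' (hlim.comp (Filter.tendsto_add_atTop_nat (N + 1)))
    fun k => by simpa [add_comm] using hmono k

/-- A zero of `w = prob (infiniteCrossing α)` at `t` makes `w` vanish almost everywhere on
`(0, α t)`. -/
lemma ae_prob_eq_zero_of_prob_eq_zero (hα : 0 < α) {t : ℝ}
    (h : prob (infiniteCrossing α) t = 0) :
    ∀ᵐ r, r ∈ Ioo 0 (α * t) → prob (infiniteCrossing α) r = 0 := by
  have hm := measurableSet_infiniteCrossing α
  have hu := measurable_probEither hm
  have hint : Measurable fun s => probEither (infiniteCrossing α) (α * (t - s)) := by fun_prop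
  rw [(isBranching_infiniteCrossing hα.le).prob_eq hm,
    lintegral_eq_zero_iff (hint.indicator measurableSet_Iic),
    Filter.EventuallyEq, expMeasure_one_eq, ae_withDensity_iff (measurable_exponentialPDF 1)] at h
  -- The substitution `r = α (t - s)` turns null sets of clocks `s` into null sets of horizons `r`.
  have hq : Measure.QuasiMeasurePreserving (fun r : ℝ => t - α⁻¹ * r) := by
    have h1 : Measure.QuasiMeasurePreserving (fun r : ℝ => α⁻¹ * r) := by
      refine ⟨by fun_prop, ?_⟩
      rw [Real.map_volume_mul_left (inv_ne_zero hα.ne')]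
      exact Measure.smul_absolutelyContinuous
    exact (Measure.measurePreserving_sub_left volume t).quasiMeasurePreserving.comp h1
  filter_upwards [hq.ae h] with r hr hr0
  have hlt : α⁻¹ * r < t := by
    rw [inv_mul_lt_iff₀ hα]; exact hr0.2
  have hpos : 0 < α⁻¹ * r := mul_pos (inv_pos.2 hα) hr0.1
  have hpdf : exponentialPDF 1 (t - α⁻¹ * r) ≠ 0 :=
    (ENNReal.ofReal_pos.2 (exponentialPDFReal_pos one_pos (by linarith))).ne'
  have h2 := hr hpdf
  rw [indicator_of_mem (by simp only [mem_Iic]; linarith), sub_sub_cancel,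
    mul_inv_cancel_left₀ hα.ne'] at h2
  exact le_antisymm ((prob_le_probEither _ r).trans h2.le) zero_le

/-- A zero at one positive horizon spreads to ever longer intervals, hence to the whole half-line.
Passing from `t` to `α t` costs an arbitrarily small factor, because the vanishing is only almost
everywhere. -/
lemma prob_infiniteCrossing_ne_zero (hα : 1 < α) (hα2 : α < 2) {t : ℝ} (ht : 0 < t) :
    prob (infiniteCrossing α) t ≠ 0 := by
  intro h
  have hα0 : 0 < α := by linarith
  have hβ : 1 < (1 + α) / 2 := by linarith
  have hspread : ∀ n : ℕ, ∀ᵐ r, r ∈ Ioo 0 (((1 + α) / 2) ^ n * t) →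
      prob (infiniteCrossing α) r = 0 := by
    intro n
    induction n with
    | zero =>
      filter_upwards [ae_prob_eq_zero_of_prob_eq_zero hα0 h] with r hr hr0
      exact hr ⟨hr0.1, hr0.2.trans (by rw [pow_zero]; gcongr)⟩
    | succ n ih =>
      -- A zero `s` close enough to the right end `c` satisfies `α s > (1 + α) / 2 * c`.
      set c := ((1 + α) / 2) ^ n * t with hc
      have hcpos : 0 < c := by positivity
      have hlt : (1 + α) / 2 / α * c < c := by
        refine mul_lt_of_lt_one_left hcpos ?_
        rw [div_lt_one hα0]
        linarith
      have hvol : volume (Ioo ((1 + α) / 2 / α * c) c) ≠ 0 := by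
        rw [Real.volume_Ioo]
        simpa using hlt
      obtain ⟨s, hs, hs0⟩ : ∃ s ∈ Ioo ((1 + α) / 2 / α * c) c,
          prob (infiniteCrossing α) s = 0 := by
        by_contra! hcon
        refine hvol (measure_mono_null (fun s hs => ?_) ih)
        exact fun hzero => hcon s hs (hzero ⟨lt_trans (by positivity) hs.1, hs.2⟩)
      filter_upwards [ae_prob_eq_zero_of_prob_eq_zero hα0 hs0] with r hr hr0
      refine hr ⟨hr0.1, hr0.2.trans ?_⟩
      calc ((1 + α) / 2) ^ (n + 1) * t = α * ((1 + α) / 2 / α * c) := by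
            rw [hc]; field_simp; ring
        _ < α * s := by gcongr; exact hs.1
  refine mass_infiniteCrossing_ne_zero hα hα2 ?_
  rw [mass, lintegral_eq_zero_iff (measurable_prob (measurableSet_infiniteCrossing α)),
    ← Measure.restrict_congr_set Ioi_ae_eq_Ici, Filter.EventuallyEq,
    ae_restrict_iff' measurableSet_Ioi]
  filter_upwards [ae_all_iff.2 hspread] with r hr hr0
  obtain ⟨n, hn⟩ := pow_unbounded_of_one_lt (r / t) hβ
  exact hr n ⟨hr0, (div_lt_iff₀ ht).1 hn⟩

end AlphaRiccati

theorem proposition2p2 {Ω : Type*} [MeasurableSpace Ω] (P : Measure Ω) [IsProbabilityMeasure P]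
    (T : TreeVertex → Ω → ℝ) (hT_meas : ∀ v, Measurable (T v))
    (hT_law : ∀ v, HasLaw (T v) (expMeasure 1) P) (hT_indep : iIndepFun T P)
    (α : ℝ) (hα : 0 ≤ α) (t : ℝ) (ht : 0 < t) :
    MeasurableSet (AlphaRiccati.finiteCrossing α T t) ∧
    (α ∈ Icc 0 1 ∪ Ici 2 → P (AlphaRiccati.finiteCrossing α T t) = 1) ∧
    (α ∈ Ioo 1 2 → P (AlphaRiccati.finiteCrossing α T t) < 1) := by
  have hmeas : Measurable fun ω v => T v ω := measurable_pi_lambda _ hT_meas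
  have hsec : MeasurableSet {τ | (τ, t) ∈ AlphaRiccati.infiniteCrossing α} :=
    (AlphaRiccati.measurableSet_infiniteCrossing α).preimage (by fun_prop)
  have hcompl : AlphaRiccati.finiteCrossing α T t =
      ((fun ω v => T v ω) ⁻¹' {τ | (τ, t) ∈ AlphaRiccati.infiniteCrossing α})ᶜ := by
    ext ω
    simp [AlphaRiccati.finiteCrossing, AlphaRiccati.infiniteCrossing]
  have hprob : P (AlphaRiccati.finiteCrossing α T t) =
      1 - AlphaRiccati.prob (AlphaRiccati.infiniteCrossing α) t := by
    rw [hcompl, prob_compl_eq_one_sub (hsec.preimage hmeas), ← Measure.map_apply hmeas hsec,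
      (hT_indep.hasLaw_infinitePi hT_law hmeas.aemeasurable).map_eq]
    rfl
  refine ⟨hcompl ▸ (hsec.preimage hmeas).compl, ?_, ?_⟩
  · rintro (h | h)
    · rw [hprob, AlphaRiccati.prob_infiniteCrossing_eq_zero_of_le_one hα h.2 ht.le, tsub_zero]
    · rw [hprob, AlphaRiccati.prob_infiniteCrossing_eq_zero_of_two_le h, tsub_zero]
  · rintro ⟨h1, h2⟩
    rw [hprob]
    exact ENNReal.sub_lt_self ENNReal.one_ne_top one_ne_zero
      (AlphaRiccati.prob_infiniteCrossing_ne_zero h1 h2 ht)
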